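/- Let $k$ be a quadratic number field with discriminant $d$. Suppose that there is an extension $M/k$ which is unramified at all finite primes, has $\operatorname{Gal}(M/k)\simeq H_8$ (the quaternion group of order $8$), and is normal over $\mathbb Q$. Then: 1. $\operatorname{Gal}(M/\mathbb Q)\simeq D_4 \curlyvee C_4$, the central product of order $16$ of the dihedral group $D_4$ of order $8$ and the cyclic group $C_4$ of order $4$, i.e. the quotient of $D_4\times C_4$ by the subgroup of order $2$ generated by the pair consisting of the central involution of $D_4$ and the involution of $C_4$. 2. There is a factorization $d=d_1d_2d_3$ in which each $d_i$ is the discriminant of a quadratic number field (in particular $d_i\neq 1$), and at most one of $d_1,d_2,d_3$ is negative. 3. For this factorization, $(d_1d_2/p_3)=(d_2d_3/p_1)=(d_3d_1/p_2)=+1$ for all primes $p_1\mid d_1$, $p_2\mid d_2$, $p_3\mid d_3$, where $(\cdot/p)$ is the Legendre symbol for odd $p$ and the Kronecker symbol for $p=2$. -/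

import Mathlib

open scoped NumberField

/-- `L/K` is unramified: no finite prime ramifies (infinite places are unrestricted). -/
def IsUnramifiedOutsideInfinity (K L : Type*) [Field K] [NumberField K] [Field L] [NumberField L]
    [Algebra K L] : Prop :=
  ∀ (P : Ideal (𝓞 L)) [P.IsPrime], P ≠ ⊥ → Algebra.IsUnramifiedAt (𝓞 K) P

/-- `D` is the discriminant of a quadratic number field. In particular `D ≠ 1`. -/
def IsQuadraticFieldDiscriminant (D : ℤ) : Prop :=
  ∃ (F : Type) (_ : Field F) (_ : NumberField F),
    Algebra.IsQuadraticExtension ℚ F ∧ NumberField.discr F = D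

/-- The Kronecker symbol `(a/p)` at a prime `p`: for odd `p` the Legendre symbol, and for `p = 2`
it is `0` for even `a`, `1` for `a ≡ ±1 mod 8` and `-1` for `a ≡ ±3 mod 8`. -/
def kroneckerAtPrime (a : ℤ) (p : ℕ) [Fact p.Prime] : ℤ :=
  if p = 2 then ZMod.χ₈ (a : ZMod 8) else legendreSym p a

/-- The subgroup of `D₄ × C₄` generated by the pair formed by the central involution of `D₄` (of
order `8`) and the involution of `C₄`. -/
def amalgamatedInvolution : Subgroup (DihedralGroup 4 × Multiplicative (ZMod 4)) :=
  Subgroup.zpowers (DihedralGroup.r 2, Multiplicative.ofAdd 2)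

instance amalgamatedInvolution_normal : amalgamatedInvolution.Normal := by
  have hc : ∀ g : DihedralGroup 4 × Multiplicative (ZMod 4),
      g * (DihedralGroup.r 2, Multiplicative.ofAdd 2) =
        (DihedralGroup.r 2, Multiplicative.ofAdd 2) * g := by
    rintro ⟨a | a, b⟩ <;> revert a b <;> decide
  refine ⟨?_⟩
  rintro n ⟨z, rfl⟩ g
  have h := (Commute.zpow_right (hc g) z).eq
  exact ⟨z, by simp only; rw [h, mul_inv_cancel_right]⟩

/-- The central product `D₄ ⋎ C₄` of order `16`: the quotient of `D₄ × C₄` identifying the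
central involution of `D₄` with the involution of `C₄`. -/
abbrev CentralProductD4C4 : Type :=
  (DihedralGroup 4 × Multiplicative (ZMod 4)) ⧸ amalgamatedInvolution

/-!
Let `G = Gal(M/ℚ)` and let `N ≅ H₈` be its subgroup `Gal(M/k)` of index two. As `M/k` is unramified,
the inertia groups of `M/ℚ` meet `N` trivially, so that each of them is trivial or generated by an
involution outside `N`; by Minkowski's theorem these involutions generate `G`. Multiplying one of
them into `N` one finds three involutions outside `N` that generate `G` and commute with each other
up to a central sign, as the Pauli matrices do. This identifies `G` with `D₄ ⋎ C₄` and provides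
three quadratic characters `χᵢ` of `G` dual to the three involutions; `dᵢ` is the discriminant of
the quadratic field cut out by `χᵢ`.

An involution of `G` is detected by at most one of the `χᵢ`. For inertia this makes the `dᵢ`
pairwise coprime, for complex conjugation it makes at most one of them negative. The product of the
`χᵢ` is trivial on `N`, so the product of the three quadratic fields is `k` and `d = d₁ d₂ d₃`.
Finally, the decomposition group of a prime above `p ∣ dᵢ` centralizes the inertia involution, and
on the centralizer of an involution detected by `χᵢ` the other two characters agree; hence `p`
splits in the quadratic field of discriminant `dⱼ dₗ`.
-/

section IndexTwo

variable {G : Type*} [Group G] {N I : Subgroup G}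

lemma sq_eq_one_of_disjoint_of_index_two (hN : N.index = 2) (hI : Disjoint I N) {g : G}
    (hg : g ∈ I) : g ^ 2 = 1 :=
  Subgroup.disjoint_def.1 hI (pow_mem hg 2) (Subgroup.sq_mem_of_index_two hN g)

lemma eq_of_disjoint_of_index_two (hN : N.index = 2) (hI : Disjoint I N) {g h : G}
    (hg : g ∈ I) (hg1 : g ≠ 1) (hh : h ∈ I) (hh1 : h ≠ 1) : g = h := by
  have notMem {x : G} (hx : x ∈ I) (hx1 : x ≠ 1) : x ∉ N := fun hxN =>
    hx1 (Subgroup.disjoint_def.1 hI hx hxN)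
  have hmem : g * h⁻¹ ∈ N := by
    rw [Subgroup.mul_mem_iff_of_index_two hN, inv_mem_iff]
    exact iff_of_false (notMem hg hg1) (notMem hh hh1)
  exact mul_inv_eq_one.1 (Subgroup.disjoint_def.1 hI (mul_mem hg (inv_mem hh)) hmem)

lemma map_eq_one_of_mem_of_closure_eq_top (hN : N.index = 2) {S : Set G}
    (hS : Subgroup.closure S = ⊤) (hSN : ∀ s ∈ S, s ∉ N) {ψ : G →* ℤˣ} (hψ : ∀ s ∈ S, ψ s = -1)
    {g : G} (hg : g ∈ N) : ψ g = 1 := by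
  suffices ∀ x ∈ Subgroup.closure S, x ∈ N ↔ ψ x = 1 from (this g (hS ▸ Subgroup.mem_top g)).1 hg
  intro x hx
  induction hx using Subgroup.closure_induction with
  | mem s hs => exact iff_of_false (hSN s hs) (by rw [hψ s hs]; decide)
  | one => simp only [one_mem, map_one]
  | mul a b _ _ iha ihb =>
    rw [Subgroup.mul_mem_iff_of_index_two hN, iha, ihb, map_mul]
    generalize ψ a = α, ψ b = β
    revert α β
    decide
  | inv a _ iha => rw [inv_mem_iff, iha, map_inv, inv_eq_one]

lemma closure_setOf_mul_sq_eq_one (hN : N.index = 2)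
    (hgen : Subgroup.closure {g : G | g ^ 2 = 1 ∧ g ∉ N} = ⊤) {t : G} (ht : t ∉ N)
    (ht2 : t ^ 2 = 1) : Subgroup.closure {a | a ∈ N ∧ (a * t) ^ 2 = 1} = N := by
  set K := Subgroup.closure {a | a ∈ N ∧ (a * t) ^ 2 = 1}
  have hKN : K ≤ N := (Subgroup.closure_le N).2 fun a ha => ha.1
  have htt : t * t = 1 := by rw [← sq, ht2]
  have ht_norm : t ∈ Subgroup.normalizer (K : Set G) := by
    refine Subgroup.normalizer_le_normalizer_closure _ fun a => and_congr ?_ ?_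
    · simp only [Subgroup.mul_mem_iff_of_index_two hN, inv_mem_iff, ht, iff_false, false_iff,
        not_not]
    · rw [inv_mul_cancel_right, ← conj_eq_one_iff (a := t), ← conj_pow, mul_assoc,
        mul_inv_cancel_right]
  -- A generator `s` of `G` is `(s * t) * t` with `s * t ∈ K`.
  have hsup : K ⊔ Subgroup.zpowers t = ⊤ := by
    rw [eq_top_iff, ← hgen, Subgroup.closure_le]
    rintro s ⟨hs2, hsN⟩
    have hst : s * t ∈ K := Subgroup.subset_closure
      ⟨(Subgroup.mul_mem_iff_of_index_two hN).2 (iff_of_false hsN ht), by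
        rw [mul_assoc, htt, mul_one, hs2]⟩
    rw [← mul_one s, ← htt, ← mul_assoc]
    exact mul_mem (Subgroup.mem_sup_left hst)
      (Subgroup.mem_sup_right (Subgroup.mem_zpowers t))
  have hK_normal : K.Normal := by
    rw [← Subgroup.normalizer_eq_top_iff, eq_top_iff, ← hsup]
    exact sup_le Subgroup.le_normalizer (Subgroup.zpowers_le.2 ht_norm)
  refine le_antisymm hKN fun n hn => ?_
  obtain ⟨a, ha, _, ⟨m, rfl⟩, rfl⟩ := Subgroup.mem_sup_of_normal_left.1 (hsup ▸ Subgroup.mem_top n)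
  obtain ⟨m, rfl | rfl⟩ := m.even_or_odd'
  · simpa only [zpow_mul, zpow_ofNat, ht2, one_zpow, mul_one] using ha
  · simp only [zpow_add_one, zpow_mul, zpow_ofNat, ht2, one_zpow, one_mul] at hn
    exact absurd ((Subgroup.mul_mem_cancel_left N (hKN ha)).1 hn) ht

end IndexTwo

section PauliTriple

/-- Three involutions whose pairwise products all square to the same element `z` of order dividing
two, so that distinct ones commute up to the sign `z`, as the Pauli matrices do. -/
structure IsPauliTriple {G : Type*} [Group G] (s : Fin 3 → G) (z : G) : Prop where
  sq_eq_one : ∀ i, s i ^ 2 = 1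
  central_sq : z ^ 2 = 1
  mul_sq : ∀ i j, i ≠ j → (s i * s j) ^ 2 = z

namespace IsPauliTriple

variable {G : Type*} [Group G] {s : Fin 3 → G} {z : G}

lemma mul_self (h : IsPauliTriple s z) (i : Fin 3) : s i * s i = 1 := by
  rw [← sq, h.sq_eq_one]

lemma inv_eq (h : IsPauliTriple s z) (i : Fin 3) : (s i)⁻¹ = s i :=
  inv_eq_of_mul_eq_one_right (h.mul_self i)

lemma semiconjBy (h : IsPauliTriple s z) {i j : Fin 3} (hij : i ≠ j) :
    SemiconjBy (s i) (s j) (z * s j) := by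
  calc s i * s j = (s i * s j) ^ 2 * ((s j)⁻¹ * (s i)⁻¹) := by
        simp only [sq, mul_assoc, mul_inv_cancel_left, mul_inv_cancel, mul_one]
    _ = z * s j * s i := by rw [h.mul_sq i j hij, h.inv_eq, h.inv_eq, mul_assoc]

lemma commute_central (h : IsPauliTriple s z) (i : Fin 3) : Commute (s i) z := by
  have hi : i ≠ i + 1 := by revert i; decide
  calc s i * z = s i * (s (i + 1) * s i) ^ 2 := by rw [h.mul_sq _ _ hi.symm]
    _ = (s i * s (i + 1)) ^ 2 * s i := by simp only [sq, mul_assoc]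
    _ = z * s i := by rw [h.mul_sq _ _ hi]

lemma commute_prod (h : IsPauliTriple s z) (i : Fin 3) : Commute (s i) (s 0 * s 1 * s 2) := by
  have hzz : z * z = 1 := by rw [← sq, h.central_sq]
  have move (j : Fin 3) (x : G) : s j * (z * x) = z * (s j * x) :=
    (h.commute_central j).left_comm x
  have cancel (x : G) : z * (z * x) = x := by rw [← mul_assoc, hzz, one_mul]
  have key : SemiconjBy (s i) (s 0 * s 1 * s 2) ((if i = 0 then s 0 else z * s 0) *
      (if i = 1 then s 1 else z * s 1) * (if i = 2 then s 2 else z * s 2)) := by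
    have conj (j : Fin 3) : SemiconjBy (s i) (s j) (if i = j then s j else z * s j) := by
      split_ifs with hij
      · exact hij ▸ Commute.refl (s i)
      · exact h.semiconjBy hij
    exact ((conj 0).mul_right (conj 1)).mul_right (conj 2)
  revert key
  fin_cases i <;> simp [mul_assoc, move, cancel, Commute]

lemma prod_sq (h : IsPauliTriple s z) : (s 0 * s 1 * s 2) ^ 2 = z := by
  calc (s 0 * s 1 * s 2) ^ 2 = s 0 * s 1 * (s 2 * (s 0 * s 1 * s 2)) := by
        rw [sq, mul_assoc (s 0 * s 1)]
    _ = (s 0 * s 1) ^ 2 * (s 2 * s 2) := by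
        rw [(h.commute_prod 2).eq, sq, mul_assoc (s 0 * s 1), mul_assoc (s 0 * s 1)]
    _ = z := by rw [h.mul_self, mul_one, h.mul_sq 0 1 (by decide)]

end IsPauliTriple

end PauliTriple

section QuaternionSubgroup

lemma quaternionGroup_sq_eq_of_not_commute : ∀ x y : QuaternionGroup 2, ¬ Commute x y →
    x ^ 4 = 1 ∧ y ^ 2 = x ^ 2 ∧ (x * y⁻¹) ^ 2 = x ^ 2 := by
  unfold Commute SemiconjBy
  decide

set_option maxRecDepth 4000 in
lemma quaternionGroup_exists_eq_pow_mul_pow : ∀ x y : QuaternionGroup 2, ¬ Commute x y →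
    ∀ n, ∃ i : Fin 4, ∃ j : Fin 2, n = x ^ (i : ℕ) * y ^ (j : ℕ) := by
  unfold Commute SemiconjBy
  decide

lemma quaternionGroup_not_isMulCommutative : ¬ IsMulCommutative (QuaternionGroup 2) := fun _ =>
  absurd (mul_comm' (.a 1 : QuaternionGroup 2) (.xa 0)) (by decide)

lemma quaternionGroup_closure_pair {x y : QuaternionGroup 2} (hxy : ¬ Commute x y) :
    Subgroup.closure {x, y} = ⊤ := by
  refine (Subgroup.eq_top_iff' _).2 fun n => ?_
  obtain ⟨i, j, rfl⟩ := quaternionGroup_exists_eq_pow_mul_pow x y hxy n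
  exact mul_mem (pow_mem (Subgroup.subset_closure (by simp)) _)
    (pow_mem (Subgroup.subset_closure (by simp)) _)

variable {G : Type*} [Group G] {N : Subgroup G}

lemma exists_notMem_sq_eq_one_of_closure_eq_top (hN : N ≠ ⊤)
    (hgen : Subgroup.closure {g : G | g ^ 2 = 1 ∧ g ∉ N} = ⊤) : ∃ t ∉ N, t ^ 2 = 1 := by
  by_contra! h
  refine hN (top_le_iff.1 (hgen ▸ (Subgroup.closure_le N).2 fun g hg => ?_))
  exact absurd hg.1 (h g hg.2)

lemma exists_not_commute_of_closure_eq {S : Set G} (hS : Subgroup.closure S = N)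
    (hN : ¬ IsMulCommutative N) : ∃ u ∈ S, ∃ v ∈ S, ¬ Commute u v := by
  by_contra! h
  exact hN (hS ▸ Subgroup.isMulCommutative_closure h)

lemma isPauliTriple_of_mul_sq_eq_one {t u v : G} (ht : t ^ 2 = 1) (hut : (u * t) ^ 2 = 1)
    (hvt : (v * t) ^ 2 = 1) (hu : u ^ 4 = 1) (hv : v ^ 2 = u ^ 2) (huv : (u * v⁻¹) ^ 2 = u ^ 2) :
    IsPauliTriple ![t, u * t, v * t] (u ^ 2) := by
  have htt : t * t = 1 := by rw [← sq, ht]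
  have hu_inv : (u ^ 2)⁻¹ = u ^ 2 := inv_eq_of_mul_eq_one_right (by rw [← pow_add, hu])
  -- The square of a product of two involutions is inverted by exchanging them.
  have symm {a b : G} (ha : a ^ 2 = 1) (hb : b ^ 2 = 1) (hab : (a * b) ^ 2 = u ^ 2) :
      (b * a) ^ 2 = u ^ 2 := by
    have : b * a = (a * b)⁻¹ := by
      rw [mul_inv_rev, inv_eq_of_mul_eq_one_right (a := a) (by rw [← sq, ha]),
        inv_eq_of_mul_eq_one_right (a := b) (by rw [← sq, hb])]
    rw [this, inv_pow, hab, hu_inv]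
  have h10 : (u * t * t) ^ 2 = u ^ 2 := by rw [mul_assoc, htt, mul_one]
  have h20 : (v * t * t) ^ 2 = u ^ 2 := by rw [mul_assoc, htt, mul_one, hv]
  have h12 : (u * t * (v * t)) ^ 2 = u ^ 2 := by
    have : t * (v * t) = v⁻¹ := by
      refine (inv_eq_of_mul_eq_one_right ?_).symm
      rw [← hvt, sq]
      simp only [mul_assoc]
    rw [mul_assoc, this, huv]
  refine ⟨fun i => ?_, by rw [← pow_mul, hu], fun i j hij => ?_⟩
  · fin_cases i
    exacts [ht, hut, hvt]
  · fin_cases i <;> fin_cases j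
    exacts [absurd rfl hij, symm hut ht h10, symm hvt ht h20, h10, absurd rfl hij, h12, h20,
      symm hut hvt h12, absurd rfl hij]

lemma closure_eq_top_of_index_two (hN : N.index = 2) {K : Subgroup G} (hNK : N ≤ K) {t : G}
    (ht : t ∉ N) (htK : t ∈ K) : K = ⊤ := by
  refine (Subgroup.eq_top_iff' K).2 fun g => ?_
  by_cases hg : g ∈ N
  · exact hNK hg
  · exact (Subgroup.mul_mem_cancel_right K htK).1
      (hNK ((Subgroup.mul_mem_iff_of_index_two hN).2 (iff_of_false hg ht)))

lemma le_of_not_commute_of_mulEquiv (e : N ≃* QuaternionGroup 2) {u v : N}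
    (huv : ¬ Commute (e u) (e v)) {K : Subgroup G} (hu : (u : G) ∈ K) (hv : (v : G) ∈ K) :
    N ≤ K := by
  have hle : Subgroup.closure {e u, e v} ≤
      K.comap (N.subtype.comp e.symm.toMonoidHom) := by
    rw [Subgroup.closure_le, Set.pair_subset_iff]
    simpa using ⟨hu, hv⟩
  rw [quaternionGroup_closure_pair huv] at hle
  intro n hn
  simpa using hle (Subgroup.mem_top (e ⟨n, hn⟩))

theorem exists_isPauliTriple (hN : N.index = 2) (e : N ≃* QuaternionGroup 2)
    (hgen : Subgroup.closure {g : G | g ^ 2 = 1 ∧ g ∉ N} = ⊤) :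
    ∃ s z, IsPauliTriple s z ∧ (∀ i, s i ∉ N) ∧ Subgroup.closure (Set.range s) = ⊤ := by
  obtain ⟨t, ht, ht2⟩ := exists_notMem_sq_eq_one_of_closure_eq_top
    (fun h => by simp [h] at hN) hgen
  have hN_comm : ¬ IsMulCommutative N := fun _ =>
    quaternionGroup_not_isMulCommutative ⟨⟨fun x y => e.symm.injective (by
      simp only [map_mul, mul_comm'])⟩⟩
  obtain ⟨u, ⟨hu, hut⟩, v, ⟨hv, hvt⟩, huv⟩ :=
    exists_not_commute_of_closure_eq (closure_setOf_mul_sq_eq_one hN hgen ht ht2) hN_comm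
  lift u to N using hu
  lift v to N using hv
  have he : ¬ Commute (e u) (e v) := fun h => huv (by
    simpa only [e.symm_apply_apply, Subgroup.coe_subtype] using (h.map e.symm).map N.subtype)
  obtain ⟨hu4, hvu, huv2⟩ : (u : G) ^ 4 = 1 ∧ (v : G) ^ 2 = (u : G) ^ 2 ∧
      ((u : G) * (v : G)⁻¹) ^ 2 = (u : G) ^ 2 := by
    have := quaternionGroup_sq_eq_of_not_commute _ _ he
    simp only [← map_pow, ← map_inv, ← map_mul, ← map_one e, e.injective.eq_iff] at this
    exact_mod_cast this
  refine ⟨![t, u * t, v * t], _, isPauliTriple_of_mul_sq_eq_one ht2 hut hvt hu4 hvu huv2,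
    fun i => ?_, ?_⟩
  · fin_cases i
    exacts [ht, fun h => ht ((N.mul_mem_cancel_left u.2).1 h),
      fun h => ht ((N.mul_mem_cancel_left v.2).1 h)]
  · set K := Subgroup.closure (Set.range ![t, u * t, v * t])
    have hsK (i : Fin 3) : ![t, u * t, v * t] i ∈ K := Subgroup.subset_closure ⟨i, rfl⟩
    have huK : (u : G) ∈ K := (K.mul_mem_cancel_right (hsK 0)).1 (hsK 1)
    have hvK : (v : G) ∈ K := (K.mul_mem_cancel_right (hsK 0)).1 (hsK 2)
    exact closure_eq_top_of_index_two hN (le_of_not_commute_of_mulEquiv e he huK hvK) ht (hsK 0)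

end QuaternionSubgroup

section CentralProduct

open DihedralGroup

variable {G : Type*} [Group G] {n : ℕ}

/-- The homomorphism from the cyclic group of order `n` sending its standard generator to `x`. -/
def cyclicLift (x : G) (hx : x ^ n = 1) : Multiplicative (ZMod n) →* G :=
  (ZMod.lift n ⟨zmultiplesHom (Additive G) (.ofMul x), by
    simpa [← ofMul_pow] using hx⟩).toMultiplicativeLeft

lemma cyclicLift_ofAdd_intCast (x : G) (hx : x ^ n = 1) (a : ℤ) :
    cyclicLift x hx (.ofAdd (a : ZMod n)) = x ^ a := by
  simp [cyclicLift]

lemma cyclicLift_ofAdd_one (x : G) (hx : x ^ n = 1) : cyclicLift x hx (.ofAdd 1) = x := by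
  simpa using cyclicLift_ofAdd_intCast x hx 1

lemma commute_cyclicLift {x y : G} (hx : x ^ n = 1) (hxy : Commute y x)
    (g : Multiplicative (ZMod n)) : Commute y (cyclicLift x hx g) := by
  obtain ⟨a, ha⟩ := ZMod.intCast_surjective g.toAdd
  rw [← ofAdd_toAdd g, ← ha, cyclicLift_ofAdd_intCast]
  exact hxy.zpow_right a

/-- The homomorphism from the dihedral group of order `2 * n` sending `r 1` to `x` and `sr 0`
to `y`. -/
def dihedralLift (x y : G) (hx : x ^ n = 1) (hy : y ^ 2 = 1) (hxy : SemiconjBy y x x⁻¹) :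
    DihedralGroup n →* G where
  toFun
    | r i => cyclicLift x hx (.ofAdd i)
    | sr i => y * cyclicLift x hx (.ofAdd i)
  map_one' := map_one (cyclicLift x hx)
  map_mul' := by
    have hyy : y * y = 1 := by rw [← sq, hy]
    have conj (i : ZMod n) :
        cyclicLift x hx (.ofAdd i) * y = y * cyclicLift x hx (.ofAdd (-i)) := by
      obtain ⟨a, rfl⟩ := ZMod.intCast_surjective i
      rw [← Int.cast_neg, cyclicLift_ofAdd_intCast, cyclicLift_ofAdd_intCast,
        (hxy.zpow_right (-a)).eq, inv_zpow', neg_neg]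
    rintro (i | i) (j | j)
    · exact map_mul (cyclicLift x hx) (.ofAdd i) (.ofAdd j)
    · change y * cyclicLift x hx (.ofAdd (j - i)) = _ * (y * _)
      rw [← mul_assoc, conj, mul_assoc, ← map_mul, ← ofAdd_add, neg_add_eq_sub]
    · change y * cyclicLift x hx (.ofAdd (i + j)) = y * _ * _
      rw [mul_assoc, ← map_mul, ← ofAdd_add]
    · change cyclicLift x hx (.ofAdd (j - i)) = y * _ * (y * _)
      rw [mul_assoc, ← mul_assoc _ y, conj, mul_assoc y, ← map_mul, ← ofAdd_add, ← mul_assoc, hyy,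
        one_mul, neg_add_eq_sub]

lemma dihedralLift_sr (x y : G) (hx : x ^ n = 1) (hy : y ^ 2 = 1) (hxy : SemiconjBy y x x⁻¹)
    (i : ZMod n) : dihedralLift x y hx hy hxy (sr i) = y * cyclicLift x hx (.ofAdd i) := rfl

namespace IsPauliTriple

variable {s : Fin 3 → G} {z : G}

lemma mul_pow_four (h : IsPauliTriple s z) : (s 0 * s 1) ^ 4 = 1 := by
  rw [show 4 = 2 * 2 from rfl, pow_mul, h.mul_sq 0 1 (by decide), h.central_sq]

lemma prod_pow_four (h : IsPauliTriple s z) : (s 0 * s 1 * s 2) ^ 4 = 1 := by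
  rw [show 4 = 2 * 2 from rfl, pow_mul, h.prod_sq, h.central_sq]

lemma semiconjBy_mul_inv (h : IsPauliTriple s z) :
    SemiconjBy (s 1) (s 0 * s 1) (s 0 * s 1)⁻¹ := by
  rw [SemiconjBy, mul_inv_rev, h.inv_eq, h.inv_eq, ← mul_assoc]

/-- The homomorphism from `D₄ × C₄` with image generated by a Pauli triple `s`: the rotation of
`D₄` maps to `s 0 * s 1`, the reflection to `s 1`, and the generator of `C₄` to the central
element `s 0 * s 1 * s 2`. -/
def coverHom (h : IsPauliTriple s z) : DihedralGroup 4 × Multiplicative (ZMod 4) →* G :=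
  (dihedralLift (s 0 * s 1) (s 1) h.mul_pow_four (h.sq_eq_one 1) h.semiconjBy_mul_inv).noncommCoprod
    (cyclicLift (s 0 * s 1 * s 2) h.prod_pow_four) fun g c => by
      have hrot (a : Multiplicative (ZMod 4)) :
          Commute (cyclicLift (s 0 * s 1) h.mul_pow_four a) (s 0 * s 1 * s 2) :=
        (commute_cyclicLift _ ((h.commute_prod 0).mul_left (h.commute_prod 1)).symm a).symm
      rcases g with i | i
      · exact commute_cyclicLift _ (hrot _) c
      · exact commute_cyclicLift _ ((h.commute_prod 1).mul_left (hrot _)) c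

end IsPauliTriple

/-- Lifts to `D₄ × C₄` of the Pauli triple generating `D₄ ⋎ C₄`. -/
def pauliLift : Fin 3 → DihedralGroup 4 × Multiplicative (ZMod 4) :=
  ![(r 1 * sr 0, 1), (sr 0, 1), ((r 1)⁻¹, .ofAdd 1)]

namespace IsPauliTriple

variable {s : Fin 3 → G} {z : G}

lemma coverHom_pauliLift (h : IsPauliTriple s z) (i : Fin 3) : h.coverHom (pauliLift i) = s i := by
  have hrot : dihedralLift _ _ h.mul_pow_four (h.sq_eq_one 1) h.semiconjBy_mul_inv (r 1) =
      s 0 * s 1 := cyclicLift_ofAdd_one _ h.mul_pow_four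
  have hrefl : dihedralLift _ _ h.mul_pow_four (h.sq_eq_one 1) h.semiconjBy_mul_inv (sr 0) =
      s 1 := by rw [dihedralLift_sr, ofAdd_zero, map_one, mul_one]
  fin_cases i
  · change dihedralLift _ _ _ _ _ (r 1 * sr 0) * cyclicLift _ _ 1 = s 0
    rw [map_mul, hrot, hrefl, map_one, mul_one, mul_assoc, h.mul_self, mul_one]
  · change dihedralLift _ _ _ _ _ (sr 0) * cyclicLift _ _ 1 = s 1
    rw [hrefl, map_one, mul_one]
  · change dihedralLift _ _ _ _ _ (r 1)⁻¹ * cyclicLift _ _ (.ofAdd 1) = s 2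
    rw [map_inv, hrot, cyclicLift_ofAdd_one, inv_mul_cancel_left]

lemma amalgamatedInvolution_le_ker_coverHom (h : IsPauliTriple s z) :
    amalgamatedInvolution ≤ h.coverHom.ker := by
  rw [amalgamatedInvolution, Subgroup.zpowers_le, MonoidHom.mem_ker]
  change cyclicLift _ h.mul_pow_four (.ofAdd ((2 : ℤ) : ZMod 4)) *
    cyclicLift _ h.prod_pow_four (.ofAdd ((2 : ℤ) : ZMod 4)) = 1
  rw [cyclicLift_ofAdd_intCast, cyclicLift_ofAdd_intCast, zpow_ofNat, zpow_ofNat,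
    h.mul_sq 0 1 (by decide), h.prod_sq, ← sq, h.central_sq]

end IsPauliTriple

lemma mem_amalgamatedInvolution_iff {x : DihedralGroup 4 × Multiplicative (ZMod 4)} :
    x ∈ amalgamatedInvolution ↔ x = 1 ∨ x = (r 2, .ofAdd 2) := by
  rw [amalgamatedInvolution, mem_zpowers_iff_mem_range_orderOf,
    orderOf_eq_prime (p := 2) (by decide) (by decide)]
  simp [Finset.range_add_one, Prod.one_eq_mk, or_comm]

lemma card_centralProductD4C4 : Nat.card CentralProductD4C4 = 16 := by
  have hcard := Subgroup.card_eq_card_quotient_mul_card_subgroup amalgamatedInvolution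
  have hinv : Nat.card amalgamatedInvolution = 2 :=
    (Nat.card_zpowers _).trans (orderOf_eq_prime (by decide) (by decide))
  rw [hinv, Nat.card_prod, DihedralGroup.nat_card, Nat.card_congr Multiplicative.toAdd,
    Nat.card_zmod] at hcard
  exact (Nat.mul_right_cancel two_pos hcard).symm

lemma IsPauliTriple.exists_mulEquiv {s : Fin 3 → G} {z : G} (h : IsPauliTriple s z)
    (hs : Subgroup.closure (Set.range s) = ⊤) (hG : Nat.card G = 16) :
    ∃ e : CentralProductD4C4 ≃* G, ∀ i, e (QuotientGroup.mk (pauliLift i)) = s i := by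
  let φ : CentralProductD4C4 →* G :=
    QuotientGroup.lift _ h.coverHom h.amalgamatedInvolution_le_ker_coverHom
  have hφ (i : Fin 3) : φ (QuotientGroup.mk (pauliLift i)) = s i := h.coverHom_pauliLift i
  have hsurj : Function.Surjective φ := by
    rw [← MonoidHom.range_eq_top, eq_top_iff, ← hs, Subgroup.closure_le]
    rintro _ ⟨i, rfl⟩
    exact ⟨_, hφ i⟩
  have := Nat.finite_of_card_ne_zero (hG.trans_ne (by decide))
  have hbij : Function.Bijective φ := by
    rw [Nat.bijective_iff_surjective_and_card]
    exact ⟨hsurj, card_centralProductD4C4.trans hG.symm⟩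
  exact ⟨MulEquiv.ofBijective φ hbij, hφ⟩

/-- The character of the dihedral group of order `8` that is `-1` on the generating rotation and
`1` on the reflection `sr 0`. -/
def rotationCharacter : DihedralGroup 4 →* ℤˣ :=
  MonoidHom.mk' (fun | r i => (-1) ^ i.val | sr i => (-1) ^ i.val) (by decide)

/-- The character of the dihedral group of order `8` with kernel the rotations. -/
def reflectionCharacter : DihedralGroup 4 →* ℤˣ :=
  MonoidHom.mk' (fun | r _ => 1 | sr _ => -1) (by decide)

/-- The nontrivial quadratic character of the cyclic group of order `4`. -/
def cyclicFourCharacter : Multiplicative (ZMod 4) →* ℤˣ :=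
  MonoidHom.mk' (fun g => (-1) ^ g.toAdd.val) (by decide)

/-- The basis of the characters of `D₄ × C₄` that are trivial on the amalgamated involution, dual
to `pauliLift`. -/
def coverCharacter : Fin 3 → DihedralGroup 4 × Multiplicative (ZMod 4) →* ℤˣ :=
  ![rotationCharacter.coprod cyclicFourCharacter,
    (rotationCharacter * reflectionCharacter).coprod cyclicFourCharacter,
    cyclicFourCharacter.comp (.snd _ _)]

lemma coverCharacter_pauliLift :
    ∀ i j, coverCharacter i (pauliLift j) = if i = j then -1 else 1 := by
  decide

lemma coverCharacter_of_sq : ∀ x : DihedralGroup 4 × Multiplicative (ZMod 4),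
    x ^ 2 = 1 ∨ x ^ 2 = (r 2, .ofAdd 2) →
    ∀ i j : Fin 3, i ≠ j → coverCharacter i x = 1 ∨ coverCharacter j x = 1 := by
  decide

set_option synthInstance.maxSize 1000 in
lemma coverCharacter_of_commutator : ∀ x y : DihedralGroup 4 × Multiplicative (ZMod 4),
    x ^ 2 = 1 ∨ x ^ 2 = (r 2, .ofAdd 2) →
    (x * y)⁻¹ * (y * x) = 1 ∨ (x * y)⁻¹ * (y * x) = (r 2, .ofAdd 2) →
    ∀ i, coverCharacter i x ≠ 1 → coverCharacter (i + 1) y = coverCharacter (i + 2) y := by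
  decide

/-- The character of `D₄ ⋎ C₄` induced by `coverCharacter i`. -/
def pauliCharacter (i : Fin 3) : CentralProductD4C4 →* ℤˣ :=
  QuotientGroup.lift amalgamatedInvolution (coverCharacter i) <| by
    rw [amalgamatedInvolution, Subgroup.zpowers_le, MonoidHom.mem_ker]
    revert i
    decide

lemma pauliCharacter_of_sq {x : CentralProductD4C4} (hx : x ^ 2 = 1) {i j : Fin 3} (hij : i ≠ j) :
    pauliCharacter i x = 1 ∨ pauliCharacter j x = 1 := by
  obtain ⟨x, rfl⟩ := QuotientGroup.mk_surjective x
  exact coverCharacter_of_sq x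
    (mem_amalgamatedInvolution_iff.1 ((QuotientGroup.eq_one_iff _).1 hx)) i j hij

lemma pauliCharacter_of_commute {x y : CentralProductD4C4} (hx : x ^ 2 = 1) (hxy : Commute x y)
    {i : Fin 3} (hi : pauliCharacter i x ≠ 1) :
    pauliCharacter (i + 1) y = pauliCharacter (i + 2) y := by
  obtain ⟨x, rfl⟩ := QuotientGroup.mk_surjective x
  obtain ⟨y, rfl⟩ := QuotientGroup.mk_surjective y
  exact coverCharacter_of_commutator x y
    (mem_amalgamatedInvolution_iff.1 ((QuotientGroup.eq_one_iff _).1 hx))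
    (mem_amalgamatedInvolution_iff.1 (QuotientGroup.eq.1 hxy)) i hi

/-- Three nontrivial quadratic characters with product trivial on `N`, among which an involution
is detected by at most one, and such that the two others agree on its centralizer. Indices are
cyclic, so that `i + 1` and `i + 2` are the two indices different from `i`. -/
structure IsDualCharacterTriple (N : Subgroup G) (χ : Fin 3 → G →* ℤˣ) : Prop where
  ne_one : ∀ i, χ i ≠ 1
  prod_eq_one : ∀ g ∈ N, ∏ i, χ i g = 1
  eq_one_or_eq_one : ∀ g, g ^ 2 = 1 → ∀ i j, i ≠ j → χ i g = 1 ∨ χ j g = 1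
  eq_of_commute : ∀ g h, g ^ 2 = 1 → Commute g h → ∀ i, χ i g ≠ 1 → χ (i + 1) h = χ (i + 2) h

theorem exists_mulEquiv_and_isDualCharacterTriple {N : Subgroup G} (hN : N.index = 2)
    (hQ : Nonempty (N ≃* QuaternionGroup 2))
    (hgen : Subgroup.closure {g : G | g ^ 2 = 1 ∧ g ∉ N} = ⊤) :
    Nonempty (G ≃* CentralProductD4C4) ∧ ∃ χ, IsDualCharacterTriple N χ := by
  obtain ⟨eN⟩ := hQ
  have hG : Nat.card G = 16 := by
    rw [← N.index_mul_card, hN, Nat.card_congr eN.toEquiv, Nat.card_eq_fintype_card,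
      QuaternionGroup.card]
  obtain ⟨s, z, hsz, hsN, hs⟩ := exists_isPauliTriple hN eN hgen
  obtain ⟨e, he⟩ := hsz.exists_mulEquiv hs hG
  let χ (i : Fin 3) : G →* ℤˣ := (pauliCharacter i).comp e.symm.toMonoidHom
  have hχ (i j : Fin 3) : χ i (s j) = if i = j then -1 else 1 := by
    rw [← coverCharacter_pauliLift, ← he]
    exact congrArg (pauliCharacter i) (e.symm_apply_apply _)
  refine ⟨⟨e.symm⟩, χ, ⟨fun i hi => ?_, fun g hg => ?_, fun g hg i j => ?_, fun g h hg hgh i => ?_⟩⟩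
  · simpa [hi] using hχ i i
  · have hprod : ∀ x ∈ Set.range s, (∏ i, χ i) x = -1 := by
      rintro _ ⟨j, rfl⟩
      simp [hχ]
    simpa using map_eq_one_of_mem_of_closure_eq_top hN hs (by simpa using hsN) hprod hg
  · exact pauliCharacter_of_sq (by rw [← map_pow, hg, map_one])
  · exact pauliCharacter_of_commute (by rw [← map_pow, hg, map_one]) (hgh.map _)

end CentralProduct

/-- The discriminant of `ℚ(√m)` for squarefree `m ≠ 1`. -/
def quadraticDiscr (m : ℤ) : ℤ := if m % 4 = 1 then m else 4 * m

section QuadraticField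

lemma rat_sq_ne_intCast_of_squarefree {m : ℤ} (hm : Squarefree m) (hm1 : m ≠ 1) (q : ℚ) :
    q ^ 2 ≠ m := by
  intro h
  obtain ⟨z, rfl⟩ := Rat.isSquare_intCast_iff.1 ⟨q, by rw [← h, sq]⟩
  exact hm1 (Int.isUnit_mul_self (hm z dvd_rfl))

lemma exists_intCast_eq_of_squarefree_mul_sq {m : ℤ} (hm : Squarefree m) {b : ℚ} {l : ℤ}
    (h : m * b ^ 2 = l) : ∃ z : ℤ, b = z := by
  have hmb : ((m : ℚ) * b) ^ 2 = ((m * l : ℤ) : ℚ) := by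
    push_cast
    rw [← h]
    ring
  obtain ⟨c, hc⟩ : ∃ c : ℤ, (c : ℚ) = m * b := IsIntegrallyClosed.isIntegral_iff.1 <|
    IsIntegral.of_pow two_pos (hmb ▸ isIntegral_algebraMap (R := ℤ) (A := ℚ))
  rw [← hc] at hmb
  obtain ⟨z, rfl⟩ : m ∣ c := (hm.dvd_pow_iff_dvd two_ne_zero).1 ⟨l, by exact_mod_cast hmb⟩
  refine ⟨z, mul_left_cancel₀ (Int.cast_ne_zero.2 hm.ne_zero) (hc.symm.trans ?_)⟩
  push_cast
  rfl

lemma even_sub_of_four_dvd_sq_sub_mul_sq {m A B : ℤ} (hm : Odd m) (h : 4 ∣ A ^ 2 - m * B ^ 2) :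
    Even (A - B) := by
  have := even_iff_two_dvd.2 (dvd_trans (by norm_num) h)
  rw [Int.even_sub, Int.even_mul, Int.even_pow' two_ne_zero, Int.even_pow' two_ne_zero,
    or_iff_right (Int.not_even_iff_odd.2 hm)] at this
  rwa [Int.even_sub]

lemma even_and_even_of_four_dvd_sq_sub_mul_sq {m A B : ℤ} (hm0 : ¬ 4 ∣ m) (hm1 : m % 4 ≠ 1)
    (h : 4 ∣ A ^ 2 - m * B ^ 2) : Even A ∧ Even B := by
  have key : ∀ m A B : ZMod 4, m ≠ 0 → m ≠ 1 → A ^ 2 - m * B ^ 2 = 0 → 2 * A = 0 ∧ 2 * B = 0 := by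
    decide
  have cast_eq_zero (a : ℤ) : (a : ZMod 4) = 0 ↔ 4 ∣ a := ZMod.intCast_zmod_eq_zero_iff_dvd a 4
  have hm1' : (m : ZMod 4) ≠ 1 := fun h1 => by
    have : ((m - 1 : ℤ) : ZMod 4) = 0 := by rw [Int.cast_sub, h1, Int.cast_one, sub_self]
    rw [cast_eq_zero] at this
    omega
  obtain ⟨hA, hB⟩ := key m A B (mt (cast_eq_zero m).1 hm0) hm1' (by
    exact_mod_cast (cast_eq_zero _).2 h)
  have hA' := (cast_eq_zero (2 * A)).1 (by exact_mod_cast hA)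
  have hB' := (cast_eq_zero (2 * B)).1 (by exact_mod_cast hB)
  constructor <;> rw [Int.even_iff] <;> omega

lemma ne_algebraMap_of_sq_eq_of_squarefree {F : Type*} [Field F] [CharZero F] {m : ℤ} {θ : F}
    (hm : Squarefree m) (hm1 : m ≠ 1) (hθ : θ ^ 2 = m) (q : ℚ) : θ ≠ algebraMap ℚ F q := by
  rintro rfl
  exact rat_sq_ne_intCast_of_squarefree hm hm1 q
    ((algebraMap ℚ F).injective (by rw [map_pow, hθ, map_intCast]))

variable {F : Type*} [Field F] [NumberField F] [Algebra.IsQuadraticExtension ℚ F] {m : ℤ} {θ : F}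

lemma trace_algebraMap_of_isQuadraticExtension (q : ℚ) :
    Algebra.trace ℚ F (algebraMap ℚ F q) = 2 * q := by
  rw [Algebra.trace_algebraMap, Algebra.IsQuadraticExtension.finrank_eq_two ℚ F, nsmul_eq_mul,
    Nat.cast_ofNat]

lemma trace_eq_zero_of_sq_eq (hm : Squarefree m) (hm1 : m ≠ 1) (hθ : θ ^ 2 = m) :
    Algebra.trace ℚ F θ = 0 := by
  obtain ⟨σ, hσ⟩ : ∃ σ : Gal(F/ℚ), σ θ ≠ θ := by
    by_contra! hfix
    obtain ⟨q, hq⟩ := IntermediateField.mem_bot.1 ((IsGalois.mem_bot_iff_fixed θ).2 hfix)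
    exact ne_algebraMap_of_sq_eq_of_squarefree hm hm1 hθ q hq.symm
  have hneg : σ θ = -θ := by
    have : (σ θ) ^ 2 = θ ^ 2 := by rw [← map_pow, hθ, map_intCast]
    exact (sq_eq_sq_iff_eq_or_eq_neg.1 this).resolve_left hσ
  have := Algebra.trace_eq_of_algEquiv σ θ
  rw [hneg, map_neg] at this
  linarith

lemma trace_add_mul_of_sq_eq (hm : Squarefree m) (hm1 : m ≠ 1) (hθ : θ ^ 2 = m) (a b : ℚ) :
    Algebra.trace ℚ F (algebraMap ℚ F a + algebraMap ℚ F b * θ) = 2 * a := by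
  rw [map_add, trace_algebraMap_of_isQuadraticExtension, ← Algebra.smul_def, map_smul,
    trace_eq_zero_of_sq_eq hm hm1 hθ, smul_zero, add_zero]

lemma exists_eq_add_mul_of_ne_algebraMap (hθ : ∀ q : ℚ, θ ≠ algebraMap ℚ F q) (x : F) :
    ∃ a b : ℚ, x = algebraMap ℚ F a + algebraMap ℚ F b * θ := by
  have hli : LinearIndependent ℚ ![(1 : F), θ] := by
    rw [LinearIndependent.pair_iff' one_ne_zero]
    exact fun q hq => hθ q (by rw [← hq, Algebra.smul_def, mul_one])
  have hspan := hli.span_eq_top_of_card_eq_finrank' (by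
    rw [Algebra.IsQuadraticExtension.finrank_eq_two ℚ F, Fintype.card_fin])
  have hx : x ∈ Submodule.span ℚ {1, θ} := by
    rw [← Matrix.range_cons_cons_empty, hspan]
    exact Submodule.mem_top
  obtain ⟨a, b, rfl⟩ := Submodule.mem_span_pair.1 hx
  exact ⟨a, b, by rw [Algebra.smul_def, Algebra.smul_def, mul_one]⟩

lemma exists_two_mul_eq_add_mul (hm : Squarefree m) (hm1 : m ≠ 1) (hθ : θ ^ 2 = m) (x : 𝓞 F) :
    ∃ A B : ℤ, 2 * (x : F) = A + B * θ ∧ 4 ∣ A ^ 2 - m * B ^ 2 := by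
  obtain ⟨a, b, hx⟩ :=
    exists_eq_add_mul_of_ne_algebraMap (ne_algebraMap_of_sq_eq_of_squarefree hm hm1 hθ) (x : F)
  -- `2 * a` is the trace of `x` and `a ^ 2 - m * b ^ 2` its norm.
  have hA : ((Algebra.trace ℤ (𝓞 F) x : ℤ) : ℚ) = 2 * a := by
    rw [Algebra.coe_trace_int, hx, trace_add_mul_of_sq_eq hm hm1 hθ]
  set A := Algebra.trace ℤ (𝓞 F) x
  have hAF : (A : F) = 2 * algebraMap ℚ F a := by simpa using congrArg (algebraMap ℚ F) hA
  obtain ⟨n, hn⟩ : ∃ n : ℤ, (n : ℚ) = a ^ 2 - m * b ^ 2 := by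
    refine IsIntegrallyClosed.isIntegral_iff.1
      ((isIntegral_algebraMap_iff (algebraMap ℚ F).injective).1 ?_)
    have hnorm : algebraMap ℚ F (a ^ 2 - m * b ^ 2) = (x : F) * (A - x) := by
      rw [hAF, hx]
      simp only [map_sub, map_mul, map_pow, map_intCast]
      rw [← hθ]
      ring
    exact hnorm ▸ x.isIntegral_coe.mul (isIntegral_algebraMap.sub x.isIntegral_coe)
  obtain ⟨B, hB⟩ := exists_intCast_eq_of_squarefree_mul_sq hm (b := 2 * b) (l := A ^ 2 - 4 * n) (by
    push_cast
    rw [hA, hn]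
    ring)
  have hBF : (B : F) = 2 * algebraMap ℚ F b := by simpa using (congrArg (algebraMap ℚ F) hB).symm
  refine ⟨A, B, by rw [hAF, hBF, hx]; ring, n, ?_⟩
  rw [← Int.cast_inj (α := ℚ)]
  push_cast
  rw [hA, hn, ← hB]
  ring

lemma discr_eq_of_forall_exists_eq_add_mul (ω : 𝓞 F) (h : ∀ x : 𝓞 F, ∃ a b : ℤ, x = a + b * ω) :
    (NumberField.discr F : ℚ) =
      2 * Algebra.trace ℚ F ((ω : F) ^ 2) - Algebra.trace ℚ F ω ^ 2 := by
  have hspan : ⊤ ≤ Submodule.span ℤ (Set.range ![(1 : 𝓞 F), ω]) := by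
    intro x _
    obtain ⟨a, b, rfl⟩ := h x
    rw [Matrix.range_cons_cons_empty, Submodule.mem_span_pair]
    exact ⟨a, b, by rw [zsmul_one, zsmul_eq_mul]⟩
  have hcard : Fintype.card (Fin 2) = Module.finrank ℤ (𝓞 F) := by
    rw [NumberField.RingOfIntegers.rank, Algebra.IsQuadraticExtension.finrank_eq_two ℚ F,
      Fintype.card_fin]
  let b : Module.Basis (Fin 2) ℤ (𝓞 F) := basisOfTopLeSpanOfCardEqFinrank _ hspan hcard
  have hb : ⇑b = ![(1 : 𝓞 F), ω] := coe_basisOfTopLeSpanOfCardEqFinrank _ _ _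
  have htrace_one : Algebra.trace ℚ F 1 = 2 := by
    simpa using trace_algebraMap_of_isQuadraticExtension (F := F) 1
  rw [← NumberField.discr_eq_discr F b, hb, Algebra.discr_def, Matrix.det_fin_two]
  simp only [Algebra.traceMatrix_apply, Algebra.traceForm_apply, Matrix.cons_val_zero,
    Matrix.cons_val_one]
  push_cast [Algebra.coe_trace_int]
  simp [htrace_one, sq]

lemma discr_eq_sq_mul_of_two_mul_eq (hm : Squarefree m) (hm1 : m ≠ 1) (hθ : θ ^ 2 = m)
    {ω : 𝓞 F} {t c : ℤ} (hω : 2 * (ω : F) = t + c * θ)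
    (h : ∀ x : 𝓞 F, ∃ a b : ℤ, x = a + b * ω) : NumberField.discr F = c ^ 2 * m := by
  have htrace : Algebra.trace ℚ F ω = t := by
    have : (ω : F) = algebraMap ℚ F (t / 2) + algebraMap ℚ F (c / 2) * θ := by
      simp only [map_div₀, map_intCast, map_ofNat]
      linear_combination (1 / 2 : F) * hω
    rw [this, trace_add_mul_of_sq_eq hm hm1 hθ]
    ring
  have htrace_sq : Algebra.trace ℚ F ((ω : F) ^ 2) = (t ^ 2 + c ^ 2 * m) / 2 := by
    have : (ω : F) ^ 2 =
        algebraMap ℚ F ((t ^ 2 + c ^ 2 * m) / 4) + algebraMap ℚ F (t * c / 2) * θ := by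
      simp only [map_div₀, map_add, map_mul, map_pow, map_intCast, map_ofNat]
      linear_combination (1 / 4 : F) * (2 * ω + t + c * θ) * hω + (c ^ 2 / 4 : F) * hθ
    rw [this, trace_add_mul_of_sq_eq hm hm1 hθ]
    ring
  have hdiscr := discr_eq_of_forall_exists_eq_add_mul ω h
  rw [htrace, htrace_sq] at hdiscr
  have : (NumberField.discr F : ℚ) = c ^ 2 * m := by rw [hdiscr]; ring
  exact_mod_cast this

lemma isIntegral_one_add_div_two {F : Type*} [Field F] [CharZero F] {θ : F} {s : ℤ}
    (hθ : θ ^ 2 = 4 * s + 1) : IsIntegral ℤ ((1 + θ) / 2) := by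
  refine ⟨Polynomial.X ^ 2 - Polynomial.X - Polynomial.C s, by monicity!, ?_⟩
  simp only [Polynomial.eval₂_sub, Polynomial.eval₂_pow, Polynomial.eval₂_X, Polynomial.eval₂_C]
  rw [eq_intCast]
  linear_combination (1 / 4 : F) * hθ

theorem discr_eq_quadraticDiscr (hm : Squarefree m) (hm1 : m ≠ 1) (hθ : θ ^ 2 = m) :
    NumberField.discr F = quadraticDiscr m := by
  rw [quadraticDiscr]
  split_ifs with hm4
  · obtain ⟨s, rfl⟩ : ∃ s : ℤ, m = 4 * s + 1 := ⟨m / 4, by omega⟩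
    let ω : 𝓞 F := ⟨(1 + θ) / 2, isIntegral_one_add_div_two (s := s) (by exact_mod_cast hθ)⟩
    have hω : 2 * (ω : F) = (1 : ℤ) + (1 : ℤ) * θ := by
      rw [show (ω : F) = (1 + θ) / 2 from rfl]
      push_cast
      ring
    rw [discr_eq_sq_mul_of_two_mul_eq hm hm1 hθ hω fun x => ?_, one_pow, one_mul]
    obtain ⟨A, B, hx, hAB⟩ := exists_two_mul_eq_add_mul hm hm1 hθ x
    obtain ⟨a, ha⟩ := even_sub_of_four_dvd_sq_sub_mul_sq (Int.odd_iff.2 (by omega)) hAB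
    refine ⟨a, B, NumberField.RingOfIntegers.ext ?_⟩
    have haF : (A : F) - B = a + a := by exact_mod_cast congrArg (Int.cast : ℤ → F) ha
    push_cast at hω
    simp only [map_add, map_mul, map_intCast]
    linear_combination (1 / 2 : F) * hx + (1 / 2 : F) * haF - (B / 2 : F) * hω
  · let ω : 𝓞 F := ⟨θ, IsIntegral.of_pow two_pos (hθ ▸ isIntegral_algebraMap (R := ℤ) (A := F))⟩
    have hω : 2 * (ω : F) = (0 : ℤ) + (2 : ℤ) * θ := by
      rw [show (ω : F) = θ from rfl]
      push_cast
      ring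
    rw [discr_eq_sq_mul_of_two_mul_eq hm hm1 hθ hω fun x => ?_]
    · norm_num
    have hm0 : ¬ 4 ∣ m := fun h => absurd (hm 2 h) (by decide)
    obtain ⟨A, B, hx, hAB⟩ := exists_two_mul_eq_add_mul hm hm1 hθ x
    obtain ⟨⟨a, rfl⟩, b, rfl⟩ := even_and_even_of_four_dvd_sq_sub_mul_sq hm0 hm4 hAB
    refine ⟨a, b, NumberField.RingOfIntegers.ext ?_⟩
    push_cast at hx hω
    simp only [map_add, map_mul, map_intCast]
    linear_combination (1 / 2 : F) * hx - (b / 2 : F) * hω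

end QuadraticField

section QuadraticDiscr

theorem isQuadraticFieldDiscriminant_quadraticDiscr {m : ℤ} (hm : Squarefree m) (hm1 : m ≠ 1) :
    IsQuadraticFieldDiscriminant (quadraticDiscr m) := by
  have hirr : Irreducible (Polynomial.X ^ 2 - Polynomial.C (m : ℚ)) :=
    X_pow_sub_C_irreducible_of_prime Nat.prime_two (rat_sq_ne_intCast_of_squarefree hm hm1)
  have : Fact (Irreducible (Polynomial.X ^ 2 - Polynomial.C (m : ℚ))) := ⟨hirr⟩
  let F := AdjoinRoot (Polynomial.X ^ 2 - Polynomial.C (m : ℚ))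
  have hfinrank : Module.finrank ℚ F = 2 := by
    rw [(AdjoinRoot.powerBasis hirr.ne_zero).finrank, AdjoinRoot.powerBasis_dim,
      Polynomial.natDegree_X_pow_sub_C]
  have hF : NumberField F :=
    { to_charZero := charZero_of_injective_algebraMap (algebraMap ℚ F).injective
      to_finiteDimensional := Module.finite_of_finrank_pos (hfinrank.symm ▸ two_pos) }
  have : Algebra.IsQuadraticExtension ℚ F := ⟨hfinrank⟩
  have hroot : (AdjoinRoot.root (Polynomial.X ^ 2 - Polynomial.C (m : ℚ)) : F) ^ 2 = m := by
    have := AdjoinRoot.eval₂_root (Polynomial.X ^ 2 - Polynomial.C (m : ℚ))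
    simp only [Polynomial.eval₂_sub, Polynomial.eval₂_pow, Polynomial.eval₂_X,
      Polynomial.eval₂_C] at this
    exact (sub_eq_zero.1 this).trans (map_intCast _ m)
  exact ⟨F, inferInstance, hF, this, discr_eq_quadraticDiscr hm hm1 hroot⟩

lemma dvd_quadraticDiscr (m : ℤ) : m ∣ quadraticDiscr m := by
  rw [quadraticDiscr]
  split_ifs
  · exact dvd_rfl
  · exact dvd_mul_left m 4

lemma quadraticDiscr_neg_iff {m : ℤ} : quadraticDiscr m < 0 ↔ m < 0 := by
  rw [quadraticDiscr]
  split_ifs <;> omega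

lemma emod_four_eq_one_of_not_two_dvd_quadraticDiscr {m : ℤ} (h : ¬ 2 ∣ quadraticDiscr m) :
    m % 4 = 1 := by
  rw [quadraticDiscr] at h
  split_ifs at h <;> omega

lemma isCoprime_of_isCoprime_quadraticDiscr {m n : ℤ}
    (h : IsCoprime (quadraticDiscr m) (quadraticDiscr n)) : IsCoprime m n :=
  (h.of_isCoprime_of_dvd_left (dvd_quadraticDiscr m)).of_isCoprime_of_dvd_right
    (dvd_quadraticDiscr n)

lemma quadraticDiscr_mul_of_emod_four_eq_one {m : ℤ} (n : ℤ) (hm : m % 4 = 1) :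
    quadraticDiscr (m * n) = quadraticDiscr m * quadraticDiscr n := by
  have : m * n % 4 = n % 4 := by rw [Int.mul_emod, hm, one_mul, Int.emod_emod_of_dvd _ dvd_rfl]
  rw [quadraticDiscr, quadraticDiscr, quadraticDiscr, this, if_pos hm, mul_ite]
  congr 1
  ring

lemma quadraticDiscr_mul {m n : ℤ} (h : IsCoprime (quadraticDiscr m) (quadraticDiscr n)) :
    quadraticDiscr (m * n) = quadraticDiscr m * quadraticDiscr n := by
  by_cases hm : 2 ∣ quadraticDiscr m
  · have hn : ¬ 2 ∣ quadraticDiscr n := fun hn => absurd (h.isUnit_of_dvd' hm hn) (by decide)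
    rw [mul_comm, quadraticDiscr_mul_of_emod_four_eq_one _
      (emod_four_eq_one_of_not_two_dvd_quadraticDiscr hn), mul_comm]
  · exact quadraticDiscr_mul_of_emod_four_eq_one _
      (emod_four_eq_one_of_not_two_dvd_quadraticDiscr hm)

lemma quadraticDiscr_prod {ι : Type*} {m : ι → ℤ} (s : Finset ι)
    (h : (s : Set ι).Pairwise fun i j => IsCoprime (quadraticDiscr (m i)) (quadraticDiscr (m j))) :
    quadraticDiscr (∏ i ∈ s, m i) = ∏ i ∈ s, quadraticDiscr (m i) := by
  classical
  induction s using Finset.induction_on with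
  | empty => rfl
  | insert i s hi ih =>
    have hs := ih (h.mono (Finset.coe_subset.2 (Finset.subset_insert i s)))
    rw [Finset.prod_insert hi, Finset.prod_insert hi, quadraticDiscr_mul, hs]
    rw [hs]
    exact IsCoprime.prod_right fun j hj => h (Finset.mem_insert_self i s)
      (Finset.mem_insert_of_mem hj) (ne_of_mem_of_not_mem hj hi).symm

end QuadraticDiscr

section Inertia

open scoped Pointwise

lemma card_inertia_eq_ramificationIdx (A G : Type*) {B : Type*} [CommRing A] [CommRing B]
    [IsDomain A] [IsDomain B] [Algebra A B] [Module.Finite A B] [Module.Flat A B] [Group G]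
    [Finite G] [MulSemiringAction G B] [IsGaloisGroup G A B] (P : Ideal B) [P.IsPrime]
    [PerfectField (P.under A).ResidueField] : Nat.card (P.inertia G) = P.ramificationIdx A := by
  rw [Ideal.card_inertia_eq_ramificationIdxIn (P.under A),
    Ideal.ramificationIdxIn_eq_ramificationIdx _ P G]

lemma inertia_eq_bot_of_isUnramifiedAt (k : Type*) {M : Type*} [Field k] [NumberField k] [Field M]
    [NumberField M] [Algebra k M] [IsGalois k M] (P : Ideal (𝓞 M)) [P.IsPrime]
    [Algebra.IsUnramifiedAt (𝓞 k) P] : P.inertia Gal(M/k) = ⊥ := by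
  refine Subgroup.eq_bot_of_card_eq _ ?_
  exact (card_inertia_eq_ramificationIdx (𝓞 k) Gal(M/k) P).trans
    (Ideal.ramificationIdx_eq_one_iff.2 inferInstance)

lemma exists_isPrime_natCast_mem (M : Type*) [Field M] [NumberField M] {p : ℕ} (hp : p.Prime) :
    ∃ P : Ideal (𝓞 M), P.IsPrime ∧ (p : 𝓞 M) ∈ P := by
  have hp' : Prime (p : ℤ) := Nat.prime_iff_prime_int.1 hp
  have : (Ideal.span {(p : ℤ)}).IsMaximal :=
    PrincipalIdealRing.isMaximal_of_irreducible hp'.irreducible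
  obtain ⟨P, hP, hPp⟩ :=
    Ideal.exists_maximal_ideal_liesOver_of_isIntegral (S := 𝓞 M) (Ideal.span {(p : ℤ)})
  refine ⟨P, hP.isPrime, ?_⟩
  exact_mod_cast (Ideal.liesOver_span_iff hP.ne_top hp').1 hPp

variable {M : Type*} [Field M] {p : ℕ} {P : Ideal (𝓞 M)} [P.IsPrime]

lemma liesOver_span_of_natCast_mem (hp : p.Prime) (hP : (p : 𝓞 M) ∈ P) :
    P.LiesOver (.span {(p : ℤ)}) :=
  (Ideal.liesOver_span_iff Ideal.IsPrime.ne_top' (Nat.prime_iff_prime_int.1 hp)).2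
    (by exact_mod_cast hP)

lemma dvd_of_intCast_mem (hp : p.Prime) (hP : (p : 𝓞 M) ∈ P) {z : ℤ} (hz : (z : 𝓞 M) ∈ P) :
    (p : ℤ) ∣ z := by
  have := liesOver_span_of_natCast_mem hp hP
  rw [← Ideal.mem_span_singleton, Ideal.mem_of_liesOver P, eq_intCast]
  exact hz

variable [NumberField M]

lemma ne_bot_of_natCast_mem (hp : p.Prime) (hP : (p : 𝓞 M) ∈ P) : P ≠ ⊥ := by
  rintro rfl
  exact hp.ne_zero (Nat.cast_eq_zero.1 hP)

variable [IsGalois ℚ M]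

variable (P) in
lemma isUnramifiedAt_under_of_inertia_le_fixingSubgroup (F : IntermediateField ℚ M)
    (h : P.inertia Gal(M/ℚ) ≤ F.fixingSubgroup) : Algebra.IsUnramifiedAt ℤ (P.under (𝓞 F)) := by
  have : IsGaloisGroup F.fixingSubgroup F M := IsGaloisGroup.intermediateField ..
  have : IsGaloisGroup F.fixingSubgroup (𝓞 F) (𝓞 M) := IsGaloisGroup.of_isFractionRing _ _ _ F M
  have hcard : Nat.card (P.inertia F.fixingSubgroup) = Nat.card (P.inertia Gal(M/ℚ)) :=
    Nat.card_congr (Subgroup.subgroupOfEquivOfLe h).toEquiv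
  have htower := Ideal.ramificationIdx_tower (R := ℤ) (P.under (𝓞 F)) P
  rw [← card_inertia_eq_ramificationIdx ℤ Gal(M/ℚ),
    ← card_inertia_eq_ramificationIdx (𝓞 F) F.fixingSubgroup, hcard] at htower
  exact Ideal.ramificationIdx_eq_one_iff.1 ((right_eq_mul₀ Nat.card_pos.ne').1 htower)

theorem eq_top_of_forall_inertia_le (H : Subgroup Gal(M/ℚ))
    (h : ∀ (P : Ideal (𝓞 M)) [P.IsPrime], P ≠ ⊥ → P.inertia Gal(M/ℚ) ≤ H) : H = ⊤ := by
  set F := IntermediateField.fixedField H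
  have hF : F.fixingSubgroup = H := IntermediateField.fixingSubgroup_fixedField H
  have hfinrank : Module.finrank ℚ F = 1 := by
    -- Minkowski: a number field other than `ℚ` is ramified at some prime.
    by_contra hne
    obtain ⟨Q, hQ, hram⟩ := NumberField.exists_not_isUnramifiedAt_int (𝒪 := 𝓞 F) hne
    obtain ⟨P, hP, ⟨rfl⟩⟩ := Ideal.exists_maximal_ideal_liesOver_of_isIntegral (S := 𝓞 M) Q
    refine hram (isUnramifiedAt_under_of_inertia_le_fixingSubgroup P F ?_)
    rw [hF]
    exact h P (Ideal.IsMaximal.ne_bot_of_isIntegral_int P)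
  rw [← hF, IntermediateField.finrank_eq_one_iff.1 hfinrank, IntermediateField.fixingSubgroup_bot]

lemma not_inertia_le_fixingSubgroup_of_dvd_discr (F : IntermediateField ℚ M) [IsGalois ℚ F]
    (hp : p.Prime) (hpF : (p : ℤ) ∣ NumberField.discr F) (hP : (p : 𝓞 M) ∈ P) :
    ¬ P.inertia Gal(M/ℚ) ≤ F.fixingSubgroup := by
  intro h
  have hp' : Prime (p : ℤ) := Nat.prime_iff_prime_int.1 hp
  have hunr := isUnramifiedAt_under_of_inertia_le_fixingSubgroup P F h
  refine (NumberField.not_dvd_discr_iff_forall_mem F (𝓞 F) hp').2 (fun Q hQ hpQ => ?_) hpF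
  have : (P.under (𝓞 F)).LiesOver (.span {(p : ℤ)}) := liesOver_span_of_natCast_mem hp
    (by rw [Ideal.mem_comap, map_natCast]; exact hP)
  have : Q.LiesOver (.span {(p : ℤ)}) := liesOver_span_of_natCast_mem hp (by exact_mod_cast hpQ)
  rw [← Ideal.ramificationIdx_eq_one_iff] at hunr ⊢
  rwa [← Ideal.ramificationIdxIn_eq_ramificationIdx (.span {(p : ℤ)}) _ Gal(F/ℚ)] at hunr ⊢

lemma exists_intCast_sub_mem_of_forall_stabilizer (hp : p.Prime) (hP : (p : 𝓞 M) ∈ P) {x : 𝓞 M}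
    (hx : ∀ g ∈ MulAction.stabilizer Gal(M/ℚ) P, g • x = x) : ∃ a : ℤ, x - a ∈ P := by
  have := liesOver_span_of_natCast_mem hp hP
  have : (Ideal.span {(p : ℤ)}).IsMaximal :=
    PrincipalIdealRing.isMaximal_of_irreducible (Nat.prime_iff_prime_int.1 hp).irreducible
  have : P.IsMaximal := Ideal.IsMaximal.of_liesOver_isMaximal P (.span {(p : ℤ)})
  let := Ideal.Quotient.field (Ideal.span {(p : ℤ)})
  let := Ideal.Quotient.field P
  have : Finite (ℤ ⧸ Ideal.span {(p : ℤ)}) :=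
    Ideal.finiteQuotientOfFreeOfNeBot _ (by simpa using hp.ne_zero)
  have hmem : Ideal.Quotient.mk P x ∈
      (⊥ : IntermediateField (ℤ ⧸ Ideal.span {(p : ℤ)}) (𝓞 M ⧸ P)) := by
    rw [IsGalois.mem_bot_iff_fixed]
    intro f
    obtain ⟨g, rfl⟩ := Ideal.Quotient.stabilizerHom_surjective Gal(M/ℚ) (Ideal.span {(p : ℤ)}) P f
    rw [Ideal.Quotient.stabilizerHom_apply]
    exact congrArg _ (hx g.1 g.2)
  obtain ⟨a, ha⟩ := IntermediateField.mem_bot.1 hmem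
  obtain ⟨a, rfl⟩ := Ideal.Quotient.mk_surjective a
  refine ⟨a, Ideal.Quotient.eq.1 (ha.symm.trans ?_)⟩
  rw [Ideal.Quotient.algebraMap_mk_of_liesOver, eq_intCast]

theorem exists_dvd_eval_of_forall_stabilizer (hp : p.Prime) (hP : (p : 𝓞 M) ∈ P) {x : M}
    (hx : ∀ g ∈ MulAction.stabilizer Gal(M/ℚ) P, g x = x) {f : Polynomial ℤ} (hf : f.Monic)
    (hfx : Polynomial.aeval x f = 0) : ∃ a : ℤ, (p : ℤ) ∣ f.eval a := by
  let y : 𝓞 M := ⟨x, f, hf, hfx⟩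
  have hfy : Polynomial.aeval y f = 0 := (Polynomial.aeval_algebraMap_eq_zero_iff M y f).1 hfx
  obtain ⟨a, ha⟩ := exists_intCast_sub_mem_of_forall_stabilizer hp hP (x := y)
    fun g hg => NumberField.RingOfIntegers.ext (hx g hg)
  refine ⟨a, dvd_of_intCast_mem hp hP ?_⟩
  have hdvd := map_dvd (Polynomial.aeval y) (Polynomial.X_sub_C_dvd_sub_C_eval (p := f) (a := a))
  simp only [map_sub, Polynomial.aeval_X, Polynomial.aeval_C, hfy, zero_sub, dvd_neg] at hdvd
  rw [eq_intCast, eq_intCast] at hdvd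
  exact P.mem_of_dvd hdvd ha

end Inertia

section Kronecker

open scoped Pointwise

lemma kroneckerAtPrime_two_eq_one {n : ℤ} (h : n % 8 = 1) : kroneckerAtPrime n 2 = 1 := by
  have hn : (n : ZMod 8) = 1 := by
    rw [← Int.cast_one]
    exact (ZMod.intCast_eq_intCast_iff' n 1 8).2 h
  rw [kroneckerAtPrime, if_pos rfl, hn]
  rfl

variable {p : ℕ} [Fact p.Prime]

lemma legendreSym_quadraticDiscr_eq_one {n a : ℤ} (hn : ¬ (p : ℤ) ∣ quadraticDiscr n)
    (ha : (p : ℤ) ∣ a ^ 2 - n) : legendreSym p (quadraticDiscr n) = 1 := by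
  have hna : (n : ZMod p) = (a : ZMod p) ^ 2 := by
    rw [← ZMod.intCast_zmod_eq_zero_iff_dvd, Int.cast_sub, Int.cast_pow, sub_eq_zero] at ha
    exact ha.symm
  rw [legendreSym.eq_one_iff p (mt (ZMod.intCast_zmod_eq_zero_iff_dvd _ p).1 hn), quadraticDiscr]
  split_ifs
  · exact ⟨a, by rw [hna, sq]⟩
  · exact ⟨2 * a, by push_cast; rw [hna]; ring⟩

theorem kroneckerAtPrime_quadraticDiscr_eq_one {M : Type*} [Field M] [NumberField M]
    [IsGalois ℚ M] {P : Ideal (𝓞 M)} [P.IsPrime] (hP : (p : 𝓞 M) ∈ P) {n : ℤ} {β : M}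
    (hβ : β ^ 2 = n) (hn : ¬ (p : ℤ) ∣ quadraticDiscr n)
    (hfix : ∀ g ∈ MulAction.stabilizer Gal(M/ℚ) P, g β = β) :
    kroneckerAtPrime (quadraticDiscr n) p = 1 := by
  have hp : p.Prime := Fact.out
  by_cases hp2 : p = 2
  · subst hp2
    have hn4 := emod_four_eq_one_of_not_two_dvd_quadraticDiscr hn
    obtain ⟨s, rfl⟩ : ∃ s : ℤ, n = 4 * s + 1 := ⟨n / 4, by omega⟩
    -- At `2` the reduction of `(1 + β) / 2`, a root of `X ^ 2 - X - s`, carries the information.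
    obtain ⟨a, ha⟩ := exists_dvd_eval_of_forall_stabilizer hp hP (x := (1 + β) / 2)
      (f := Polynomial.X ^ 2 - Polynomial.X - Polynomial.C s)
      (fun g hg => by rw [map_div₀, map_add, hfix g hg, map_one, map_ofNat]) (by monicity!) (by
        push_cast at hβ
        simp only [map_sub, map_pow, Polynomial.aeval_X, Polynomial.aeval_C]
        rw [eq_intCast]
        linear_combination (1 / 4 : M) * hβ)
    simp only [Polynomial.eval_sub, Polynomial.eval_pow, Polynomial.eval_X,
      Polynomial.eval_C] at ha
    have heven : 2 ∣ a ^ 2 - a := by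
      rw [sq, ← mul_sub_one]
      exact (Int.even_mul_pred_self a).two_dvd
    rw [quadraticDiscr, if_pos hn4]
    exact kroneckerAtPrime_two_eq_one (by omega)
  · obtain ⟨a, ha⟩ := exists_dvd_eval_of_forall_stabilizer hp hP hfix
      (Polynomial.monic_X_pow_sub_C n two_ne_zero) (by
        simp only [map_sub, map_pow, Polynomial.aeval_X, hβ, Polynomial.aeval_C]
        rw [eq_intCast, sub_self])
    rw [Polynomial.eval_sub, Polynomial.eval_pow, Polynomial.eval_X, Polynomial.eval_C] at ha
    rw [kroneckerAtPrime, if_neg hp2]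
    exact legendreSym_quadraticDiscr_eq_one hn ha

end Kronecker

section QuadraticCharacter

lemma exists_squarefree_mul_sq {q : ℚ} (hq : q ≠ 0) :
    ∃ (m : ℤ) (r : ℚ), Squarefree m ∧ r ≠ 0 ∧ q = m * r ^ 2 := by
  have hz : q.num * q.den ≠ 0 := mul_ne_zero (Rat.num_ne_zero.2 hq) (Nat.cast_ne_zero.2 q.den_nz)
  obtain ⟨a, b, hab, ha⟩ := Nat.sq_mul_squarefree (q.num * q.den).natAbs
  have hb : b ≠ 0 := by
    rintro rfl
    exact Int.natAbs_ne_zero.2 hz (by rw [← hab, zero_pow two_ne_zero, zero_mul])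
  have hden : (q.den : ℚ) ≠ 0 := Nat.cast_ne_zero.2 q.den_nz
  refine ⟨(q.num * q.den).sign * a, b / q.den, ?_, div_ne_zero (Nat.cast_ne_zero.2 hb) hden, ?_⟩
  · rwa [← Int.squarefree_natAbs, Int.natAbs_mul, Int.natAbs_sign_of_ne_zero hz, one_mul,
      Int.natAbs_natCast]
  · have habs := Int.sign_mul_natAbs (q.num * q.den)
    rw [← hab] at habs
    have hqden : (q.num * q.den).sign * (b ^ 2 * a) = q * q.den ^ 2 := by
      rw [sq (q.den : ℚ), ← mul_assoc q, Rat.mul_den_eq_num]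
      exact_mod_cast habs
    rw [div_pow, ← mul_div_assoc, eq_div_iff (pow_ne_zero 2 hden), ← hqden]
    push_cast
    ring

lemma units_intCast_sq {R : Type*} [Ring R] (u : ℤˣ) : ((u : ℤ) : R) ^ 2 = 1 := by
  rw [← Int.cast_pow, ← Units.val_pow_eq_pow_val, Int.units_sq, Units.val_one, Int.cast_one]

lemma units_intCast_mul_eq_self_iff {R : Type*} [Ring R] [CharZero R] [IsDomain R] {x : R}
    (hx : x ≠ 0) {u : ℤˣ} : ((u : ℤ) : R) * x = x ↔ u = 1 := by
  rw [mul_eq_right₀ hx, ← Int.cast_one, Int.cast_inj, Units.val_eq_one]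

variable {M : Type*} [Field M] [NumberField M]

lemma exists_ne_zero_forall_apply_eq_mul (χ : Gal(M/ℚ) →* ℤˣ) :
    ∃ θ : M, θ ≠ 0 ∧ ∀ σ : Gal(M/ℚ), σ θ = ((χ σ : ℤ) : M) * θ := by
  let f : Gal(M/ℚ) → Mˣ := fun σ => Units.map (Int.castRingHom M).toMonoidHom (χ σ)
  have hf : groupCohomology.IsMulCocycle₁ f := fun σ τ => Units.ext (by simp [f, mul_comm])
  obtain ⟨θ, hθ⟩ := groupCohomology.isMulCoboundary₁_of_isMulCocycle₁_of_aut_to_units f hf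
  exact ⟨θ, θ.ne_zero, fun σ => congrArg Units.val (div_eq_iff_eq_mul.1 (hθ σ))⟩

/-- `θ` is a square root of the squarefree integer `m ≠ 1` and `Gal(M/ℚ)` acts on it through `χ`,
so that `χ` is the quadratic character cutting out the subfield `ℚ(√m)` of `M`. -/
structure IsCharacterSqrt (χ : Gal(M/ℚ) →* ℤˣ) (m : ℤ) (θ : M) : Prop where
  squarefree : Squarefree m
  ne_one : m ≠ 1
  sq_eq : θ ^ 2 = m
  apply_eq : ∀ σ : Gal(M/ℚ), σ θ = ((χ σ : ℤ) : M) * θ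

theorem exists_isCharacterSqrt [IsGalois ℚ M] {χ : Gal(M/ℚ) →* ℤˣ} (hχ : χ ≠ 1) :
    ∃ (m : ℤ) (θ : M), IsCharacterSqrt χ m θ := by
  obtain ⟨β, hβ0, hβ⟩ := exists_ne_zero_forall_apply_eq_mul χ
  obtain ⟨q, hq⟩ : ∃ q : ℚ, algebraMap ℚ M q = β ^ 2 := by
    refine IntermediateField.mem_bot.1 ((IsGalois.mem_bot_iff_fixed _).2 fun σ => ?_)
    rw [map_pow, hβ, mul_pow, units_intCast_sq, one_mul]
  have hq0 : q ≠ 0 := by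
    rintro rfl
    exact hβ0 (pow_eq_zero_iff two_ne_zero |>.1 (hq.symm.trans (map_zero _)))
  obtain ⟨m, r, hm, hr, rfl⟩ := exists_squarefree_mul_sq hq0
  have hrM : algebraMap ℚ M r ≠ 0 := (map_ne_zero _).2 hr
  set θ := β / algebraMap ℚ M r
  have hθ0 : θ ≠ 0 := div_ne_zero hβ0 hrM
  have hθ (σ : Gal(M/ℚ)) : σ θ = ((χ σ : ℤ) : M) * θ := by
    rw [map_div₀, hβ, AlgEquiv.commutes, mul_div_assoc]
  have hsq : θ ^ 2 = m := by
    rw [div_pow, ← hq, map_mul, map_pow, map_intCast, mul_div_cancel_right₀ _ (pow_ne_zero 2 hrM)]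
  refine ⟨m, θ, hm, ?_, hsq, hθ⟩
  rintro rfl
  refine hχ (MonoidHom.ext fun σ => (units_intCast_mul_eq_self_iff hθ0).1 ?_)
  rw [← hθ]
  rcases sq_eq_one_iff.1 (hsq.trans Int.cast_one) with h | h <;> simp [h]

namespace IsCharacterSqrt

variable {χ : Gal(M/ℚ) →* ℤˣ} {m : ℤ} {θ : M}

lemma apply_eq_self_iff (h : IsCharacterSqrt χ m θ) {σ : Gal(M/ℚ)} : σ θ = θ ↔ χ σ = 1 := by
  have hθ : θ ≠ 0 := by
    rintro rfl
    have := h.sq_eq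
    rw [zero_pow two_ne_zero, eq_comm, Int.cast_eq_zero] at this
    exact h.squarefree.ne_zero this
  rw [h.apply_eq, units_intCast_mul_eq_self_iff hθ]

open IntermediateField in
lemma isQuadraticExtension_adjoin (h : IsCharacterSqrt χ m θ) :
    Algebra.IsQuadraticExtension ℚ ℚ⟮θ⟯ := by
  have hmin : minpoly ℚ θ = Polynomial.X ^ 2 - Polynomial.C (m : ℚ) :=
    (minpoly.eq_of_irreducible_of_monic (X_pow_sub_C_irreducible_of_prime Nat.prime_two
      (rat_sq_ne_intCast_of_squarefree h.squarefree h.ne_one)) (by simp [h.sq_eq])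
      (Polynomial.monic_X_pow_sub_C _ two_ne_zero)).symm
  constructor
  rw [adjoin.finrank (Algebra.IsIntegral.isIntegral θ), hmin, Polynomial.natDegree_X_pow_sub_C]

open IntermediateField in
lemma exists_mem_inertia_apply_ne_one [IsGalois ℚ M] (h : IsCharacterSqrt χ m θ) {p : ℕ}
    (hp : p.Prime) (hpm : (p : ℤ) ∣ quadraticDiscr m) {P : Ideal (𝓞 M)} [P.IsPrime]
    (hP : (p : 𝓞 M) ∈ P) : ∃ g ∈ P.inertia Gal(M/ℚ), χ g ≠ 1 := by
  have := h.isQuadraticExtension_adjoin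
  have hgen : AdjoinSimple.gen ℚ θ ^ 2 = (m : ℚ⟮θ⟯) := Subtype.ext (by simpa using h.sq_eq)
  rw [← discr_eq_quadraticDiscr h.squarefree h.ne_one hgen] at hpm
  by_contra! hfix
  refine not_inertia_le_fixingSubgroup_of_dvd_discr ℚ⟮θ⟯ hp hpm hP ?_
  rw [← IntermediateField.le_iff_le, adjoin_simple_le_iff]
  exact fun g => h.apply_eq_self_iff.2 (hfix g g.2)

end IsCharacterSqrt

end QuadraticCharacter

lemma sq_ne_intCast_of_conj_eq_self {z : ℂ} (hz : starRingEnd ℂ z = z) {m : ℤ} (hm : m < 0) :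
    z ^ 2 ≠ m := by
  obtain ⟨r, rfl⟩ := Complex.conj_eq_iff_real.1 hz
  intro h
  have : r ^ 2 = m := by exact_mod_cast h
  exact (this ▸ sq_nonneg r).not_gt (Int.cast_lt_zero.2 hm)

lemma exists_sq_eq_one_forall_sqrt_neg_apply_ne (M : Type*) [Field M] [NumberField M]
    [IsGalois ℚ M] :
    ∃ c : Gal(M/ℚ), c ^ 2 = 1 ∧ ∀ (m : ℤ) (θ : M), m < 0 → θ ^ 2 = m → c θ ≠ θ := by
  obtain ⟨φ⟩ : Nonempty (M →+* ℂ) := inferInstance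
  obtain ⟨τ, hτ⟩ := NumberField.ComplexEmbedding.exists_comp_symm_eq_of_comp_eq (k := ℚ) φ
    (NumberField.ComplexEmbedding.conjugate φ) (Subsingleton.elim _ _)
  have hconj (x : M) : φ (τ.symm x) = starRingEnd ℂ (φ x) := DFunLike.congr_fun hτ x
  refine ⟨τ.symm, AlgEquiv.ext fun x => φ.injective ?_, fun m θ hm hθ hfix => ?_⟩
  · rw [sq, AlgEquiv.mul_apply, hconj, hconj, Complex.conj_conj, AlgEquiv.one_apply]
  · exact sq_ne_intCast_of_conj_eq_self ((hconj θ).symm.trans (congrArg φ hfix)) hm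
      (by rw [← map_pow, hθ, map_intCast])

section RelativeGalois

/-- The Galois group `Gal(L/F)`, viewed as a subgroup of `Gal(L/K)`. -/
def relativeGalois (K F L : Type*) [Field K] [Field F] [Field L] [Algebra K F] [Algebra F L]
    [Algebra K L] [IsScalarTower K F L] : Subgroup Gal(L/K) :=
  (AlgEquiv.restrictScalarsHom K : Gal(L/F) →* Gal(L/K)).range

variable (K F L : Type*) [Field K] [Field F] [Field L] [Algebra K F] [Algebra F L] [Algebra K L]
  [IsScalarTower K F L]

/-- The identification of `Gal(L/F)` with its image in `Gal(L/K)`. -/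
noncomputable def relativeGaloisEquiv : Gal(L/F) ≃* relativeGalois K F L :=
  MonoidHom.ofInjective (AlgEquiv.restrictScalarsHom_injective K)

lemma index_relativeGalois [FiniteDimensional K L] [IsGalois K L] :
    (relativeGalois K F L).index = Module.finrank K F := by
  have : FiniteDimensional F L := FiniteDimensional.right K F L
  have : IsGalois F L := IsGalois.tower_top_of_isGalois K F L
  have hcard := (relativeGalois K F L).index_mul_card
  rw [← Nat.card_congr (relativeGaloisEquiv K F L).toEquiv, IsGalois.card_aut_eq_finrank,
    IsGalois.card_aut_eq_finrank, ← Module.finrank_mul_finrank K F L] at hcard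
  exact Nat.eq_of_mul_eq_mul_right Module.finrank_pos hcard

variable {k M : Type*} [Field k] [NumberField k] [Field M] [NumberField M] [Algebra k M]
  [IsGalois ℚ M]

lemma disjoint_inertia_relativeGalois (hunr : IsUnramifiedOutsideInfinity k M) (P : Ideal (𝓞 M))
    [P.IsPrime] (hP : P ≠ ⊥) : Disjoint (P.inertia Gal(M/ℚ)) (relativeGalois ℚ k M) := by
  have : IsGalois k M := IsGalois.tower_top_of_isGalois ℚ k M
  have := hunr P hP
  rw [Subgroup.disjoint_def]
  rintro _ hg ⟨g, rfl⟩
  have hgk : g ∈ P.inertia Gal(M/k) := hg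
  rw [inertia_eq_bot_of_isUnramifiedAt, Subgroup.mem_bot] at hgk
  rw [hgk, map_one]

end RelativeGalois

section InertiaDisjoint

open scoped Pointwise

lemma commute_of_mem_inertia_of_mem_stabilizer {G B : Type*} [Group G] [CommRing B]
    [MulSemiringAction G B] {N : Subgroup G} (hN : N.index = 2) {P : Ideal B}
    (hdisj : Disjoint (P.inertia G) N) {g h : G} (hg : g ∈ P.inertia G)
    (hh : h ∈ MulAction.stabilizer G P) : Commute g h := by
  by_cases hg1 : g = 1
  · exact hg1 ▸ Commute.one_left h
  have hnormal : (P.inertia (MulAction.stabilizer G P)).Normal := inferInstance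
  have hconj : h * g * h⁻¹ ∈ P.inertia G :=
    hnormal.conj_mem ⟨g, Ideal.inertia_le_stabilizer P hg⟩ hg ⟨h, hh⟩
  have hconj_eq : h * g * h⁻¹ = g :=
    eq_of_disjoint_of_index_two hN hdisj hconj (mt conj_eq_one_iff.1 hg1) hg hg1
  exact (mul_inv_eq_iff_eq_mul.1 hconj_eq).symm

variable {M : Type*} [Field M] [NumberField M] [IsGalois ℚ M] {N : Subgroup Gal(M/ℚ)}

theorem closure_involutions_eq_top (hN : N.index = 2)
    (hdisj : ∀ (P : Ideal (𝓞 M)) [P.IsPrime], P ≠ ⊥ → Disjoint (P.inertia Gal(M/ℚ)) N) :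
    Subgroup.closure {g : Gal(M/ℚ) | g ^ 2 = 1 ∧ g ∉ N} = ⊤ := by
  refine eq_top_of_forall_inertia_le _ fun P _ hP g hg => ?_
  by_cases hgN : g ∈ N
  · rw [Subgroup.disjoint_def.1 (hdisj P hP) hg hgN]
    exact one_mem _
  · exact Subgroup.subset_closure ⟨sq_eq_one_of_disjoint_of_index_two hN (hdisj P hP) hg, hgN⟩

end InertiaDisjoint

lemma prod_ne_one_of_forall_ne_one {m : Fin 3 → ℤ} (hm : ∀ i, m i ≠ 1) : ∏ i, m i ≠ 1 := by
  intro h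
  have hneg (i : Fin 3) : m i = -1 := (Int.isUnit_iff.1 (isUnit_of_dvd_one
    (h ▸ Finset.dvd_prod_of_mem m (Finset.mem_univ i)))).resolve_left (hm i)
  simp [hneg] at h

namespace IsDualCharacterTriple

variable {M : Type*} [Field M] [NumberField M] [IsGalois ℚ M] {N : Subgroup Gal(M/ℚ)}
  {χ : Fin 3 → Gal(M/ℚ) →* ℤˣ} {m : Fin 3 → ℤ} {θ : Fin 3 → M}

lemma pairwise_isCoprime_quadraticDiscr (h : IsDualCharacterTriple N χ) (hN : N.index = 2)
    (hdisj : ∀ (P : Ideal (𝓞 M)) [P.IsPrime], P ≠ ⊥ → Disjoint (P.inertia Gal(M/ℚ)) N)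
    (hθ : ∀ i, IsCharacterSqrt (χ i) (m i) (θ i)) :
    Pairwise fun i j => IsCoprime (quadraticDiscr (m i)) (quadraticDiscr (m j)) := by
  intro i j hij
  refine Int.isCoprime_iff_nat_coprime.2 (Nat.coprime_of_dvd fun p hp hpi hpj => ?_)
  rw [← Int.natCast_dvd] at hpi hpj
  obtain ⟨P, _, hpP⟩ := exists_isPrime_natCast_mem M hp
  have hP := hdisj P (ne_bot_of_natCast_mem hp hpP)
  obtain ⟨g, hg, hgi⟩ := (hθ i).exists_mem_inertia_apply_ne_one hp hpi hpP
  obtain ⟨g', hg', hgj⟩ := (hθ j).exists_mem_inertia_apply_ne_one hp hpj hpP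
  obtain rfl : g = g' := eq_of_disjoint_of_index_two hN hP hg (by rintro rfl; simp at hgi) hg'
    (by rintro rfl; simp at hgj)
  exact (h.eq_one_or_eq_one g (sq_eq_one_of_disjoint_of_index_two hN hP hg) i j hij).elim hgi hgj

lemma not_neg_and_neg (h : IsDualCharacterTriple N χ)
    (hθ : ∀ i, IsCharacterSqrt (χ i) (m i) (θ i)) {i j : Fin 3} (hij : i ≠ j) :
    ¬ (m i < 0 ∧ m j < 0) := by
  rintro ⟨hi, hj⟩
  obtain ⟨c, hc, hneg⟩ := exists_sq_eq_one_forall_sqrt_neg_apply_ne M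
  rcases h.eq_one_or_eq_one c hc i j hij with h1 | h1
  · exact hneg _ _ hi (hθ i).sq_eq ((hθ i).apply_eq_self_iff.2 h1)
  · exact hneg _ _ hj (hθ j).sq_eq ((hθ j).apply_eq_self_iff.2 h1)

lemma kroneckerAtPrime_mul_eq_one (h : IsDualCharacterTriple N χ) (hN : N.index = 2)
    (hdisj : ∀ (P : Ideal (𝓞 M)) [P.IsPrime], P ≠ ⊥ → Disjoint (P.inertia Gal(M/ℚ)) N)
    (hθ : ∀ i, IsCharacterSqrt (χ i) (m i) (θ i)) {p : ℕ} [hp : Fact p.Prime] (i : Fin 3)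
    (hpi : (p : ℤ) ∣ quadraticDiscr (m i)) :
    kroneckerAtPrime (quadraticDiscr (m (i + 1)) * quadraticDiscr (m (i + 2))) p = 1 := by
  have hcop := h.pairwise_isCoprime_quadraticDiscr hN hdisj hθ
  obtain ⟨P, _, hpP⟩ := exists_isPrime_natCast_mem M hp.out
  have hP := hdisj P (ne_bot_of_natCast_mem hp.out hpP)
  obtain ⟨g, hg, hgi⟩ := (hθ i).exists_mem_inertia_apply_ne_one hp.out hpi hpP
  have hmul := quadraticDiscr_mul (hcop (i := i + 1) (j := i + 2) (by simp))
  rw [← hmul]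
  refine kroneckerAtPrime_quadraticDiscr_eq_one hpP (β := θ (i + 1) * θ (i + 2)) ?_ ?_ ?_
  · rw [mul_pow, (hθ _).sq_eq, (hθ _).sq_eq, Int.cast_mul]
  · rw [hmul]
    intro hdvd
    have hcop_mul := (hcop (i := i) (j := i + 1) (by simp)).mul_right
      (hcop (i := i) (j := i + 2) (by simp))
    exact (Nat.prime_iff_prime_int.1 hp.out).not_isUnit (hcop_mul.isUnit_of_dvd' hpi hdvd)
  · intro σ hσ
    -- Inertia is generated by the involution `g`, so the decomposition group centralizes `g`.
    have hgσ := commute_of_mem_inertia_of_mem_stabilizer hN hP hg hσ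
    rw [map_mul, (hθ _).apply_eq, (hθ _).apply_eq, mul_mul_mul_comm,
      h.eq_of_commute g σ (sq_eq_one_of_disjoint_of_index_two hN hP hg) hgσ i hgi, ← sq,
      units_intCast_sq, one_mul]

variable {k : Type*} [Field k] [NumberField k] [Algebra.IsQuadraticExtension ℚ k] [Algebra k M]

lemma discr_eq_prod_quadraticDiscr (h : IsDualCharacterTriple (relativeGalois ℚ k M) χ)
    (hcop : Pairwise fun i j => IsCoprime (quadraticDiscr (m i)) (quadraticDiscr (m j)))
    (hθ : ∀ i, IsCharacterSqrt (χ i) (m i) (θ i)) :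
    NumberField.discr k = ∏ i, quadraticDiscr (m i) := by
  have : IsGalois k M := IsGalois.tower_top_of_isGalois ℚ k M
  have hfix (σ : Gal(M/k)) : σ (∏ i, θ i) = ∏ i, θ i := by
    have hσ := h.prod_eq_one _ ⟨σ, rfl⟩
    have hact (i : Fin 3) := (hθ i).apply_eq (AlgEquiv.restrictScalarsHom ℚ σ)
    rw [← Units.val_eq_one, Units.coe_prod] at hσ
    calc σ (∏ i, θ i) = ∏ i, AlgEquiv.restrictScalarsHom ℚ σ (θ i) := map_prod ..
      _ = ((∏ i, (χ i (AlgEquiv.restrictScalarsHom ℚ σ) : ℤ) : ℤ) : M) * ∏ i, θ i := by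
        rw [Int.cast_prod, ← Finset.prod_mul_distrib]
        exact Finset.prod_congr rfl fun i _ => hact i
      _ = ∏ i, θ i := by rw [hσ, Int.cast_one, one_mul]
  obtain ⟨y, hy⟩ := IntermediateField.mem_bot.1 ((IsGalois.mem_bot_iff_fixed _).2 hfix)
  have hy_sq : y ^ 2 = ((∏ i, m i : ℤ) : k) := (algebraMap k M).injective (by
    rw [map_pow, hy, map_intCast, ← Finset.prod_pow, Int.cast_prod]
    exact Finset.prod_congr rfl fun i _ => (hθ i).sq_eq)
  have hsqf : Squarefree (∏ i, m i) := Finset.squarefree_prod_of_pairwise_isCoprime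
    (fun i _ j _ hij => (isCoprime_of_isCoprime_quadraticDiscr (hcop hij)).isRelPrime)
    fun i _ => (hθ i).squarefree
  rw [← quadraticDiscr_prod _ (hcop.set_pairwise _)]
  exact discr_eq_quadraticDiscr hsqf (prod_ne_one_of_forall_ne_one fun i => (hθ i).ne_one) hy_sq

end IsDualCharacterTriple

theorem mainTheorem3
    (k : Type*) [Field k] [NumberField k] [Algebra.IsQuadraticExtension ℚ k]
    (M : Type*) [Field M] [NumberField M] [Algebra k M]
    (hunr : IsUnramifiedOutsideInfinity k M)
    (hH8 : Nonempty (Gal(M/k) ≃* QuaternionGroup 2))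
    (hnormal : IsGalois ℚ M) :
    Nonempty (Gal(M/ℚ) ≃* CentralProductD4C4) ∧
    ∃ d₁ d₂ d₃ : ℤ,
      IsQuadraticFieldDiscriminant d₁ ∧ IsQuadraticFieldDiscriminant d₂ ∧
      IsQuadraticFieldDiscriminant d₃ ∧
      NumberField.discr k = d₁ * d₂ * d₃ ∧
      (¬ (d₁ < 0 ∧ d₂ < 0) ∧ ¬ (d₁ < 0 ∧ d₃ < 0) ∧ ¬ (d₂ < 0 ∧ d₃ < 0)) ∧
      ∀ (p : ℕ) [Fact p.Prime],
        ((p : ℤ) ∣ d₃ → kroneckerAtPrime (d₁ * d₂) p = 1) ∧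
        ((p : ℤ) ∣ d₁ → kroneckerAtPrime (d₂ * d₃) p = 1) ∧
        ((p : ℤ) ∣ d₂ → kroneckerAtPrime (d₃ * d₁) p = 1) := by
  have hN : (relativeGalois ℚ k M).index = 2 := by
    rw [index_relativeGalois, Algebra.IsQuadraticExtension.finrank_eq_two ℚ k]
  have hdisj (P : Ideal (𝓞 M)) [P.IsPrime] := disjoint_inertia_relativeGalois hunr P
  obtain ⟨hG, χ, hχ⟩ := exists_mulEquiv_and_isDualCharacterTriple hN
    (hH8.map (relativeGaloisEquiv ℚ k M).symm.trans) (closure_involutions_eq_top hN hdisj)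
  choose m θ hθ using fun i => exists_isCharacterSqrt (hχ.ne_one i)
  have hcop := hχ.pairwise_isCoprime_quadraticDiscr hN hdisj hθ
  have hdiscr (i : Fin 3) : IsQuadraticFieldDiscriminant (quadraticDiscr (m i)) :=
    isQuadraticFieldDiscriminant_quadraticDiscr (hθ i).squarefree (hθ i).ne_one
  have hsign {i j : Fin 3} (hij : i ≠ j) :
      ¬ (quadraticDiscr (m i) < 0 ∧ quadraticDiscr (m j) < 0) := by
    rw [quadraticDiscr_neg_iff, quadraticDiscr_neg_iff]
    exact hχ.not_neg_and_neg hθ hij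
  refine ⟨hG, quadraticDiscr (m 0), quadraticDiscr (m 1), quadraticDiscr (m 2), hdiscr 0, hdiscr 1,
    hdiscr 2, ?_, ⟨hsign (by decide), hsign (by decide), hsign (by decide)⟩, fun p _ => ?_⟩
  · rw [hχ.discr_eq_prod_quadraticDiscr hcop hθ, Fin.prod_univ_three]
  · have hkron := hχ.kroneckerAtPrime_mul_eq_one (p := p) hN hdisj hθ
    exact ⟨hkron 2, hkron 0, hkron 1⟩
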